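/- Let $G$ be a finite connected bipartite plane graph (multiple edges allowed) with at least one edge, whose vertices are properly colored black and white, and suppose that $G$ has property $(*)$: every edge of $G$ is in some perfect matching (dimer) of $G$. Plane graphs are considered up to orientation-preserving homeomorphism of the plane, i.e. $G$ is given by the cyclic orders of the edge-ends around its vertices (a rotation system) satisfying $|V|-|E|+|F|=2$, together with the choice of the infinite face. Let $\mathrm{Faces}(G)$ be the set of non-infinite faces. An edge in the boundary of $f\in \mathrm{Faces}(G)$ is black-white in $f$ if, going around $f$ clockwise, one sees first its black and then its white vertex; otherwise it is white-black in $f$. If the boundary of $f$ is a cycle and a dimer $M'$ contains all black-white edges of $f$, the down-flip of $M'$ at $f$ replaces them with the white-black edges of $f$. Order the set $\mathcal D_G$ of dimers by $M\le M'$ if $M$ is obtained from $M'$ by a sequence of down-flips, and let $\hat 0$ be the minimum. The multivariate rank of $M\in\mathcal D_G$ is $\mathrm{mrk}(M)=y_{f_1}\cdots y_{f_\ell}$, where $\hat 0=M_0\lessdot M_1\lessdot\cdots\lessdot M_\ell=M$ is any saturated chain and $M_{i-1},M_i$ are related by a flip at $f_i$; the dimer face polynomial is $D_G=\sum_{M\in\mathcal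 D_G}\mathrm{mrk}(M)$. Its Newton polytope $\mathrm{Newton}(D_G)\subseteq\mathbb R^{\mathrm{Faces}(G)}$ is the convex hull of the exponent vectors of its monomials with nonzero coefficient. A subgraph $H$ of $G$ is elementary if it contains every vertex of $G$ and every edge of $H$ is used in some perfect matching of $H$ (the edgeless spanning subgraph is elementary). Then the face lattice of $\mathrm{Newton}(D_G)$ (all faces, including $\emptyset$ and the polytope itself, ordered by inclusion) is isomorphic to the lattice of all elementary subgraphs of $G$, ordered by inclusion. Moreover, a spanning subgraph $H$ of $G$ is elementary if and only if its edge set is the union of a (possibly empty) family of perfect matchings of $G$. -/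

import Mathlib

open scoped Graph

noncomputable section

namespace DimerNewton

/-! ### Perfect matchings and elementary subgraphs of a multigraph -/

/-- A perfect matching of a (loopless) multigraph `G`: a set of edges of `G` such that every vertex
of `G` is incident with exactly one of them. -/
def IsPerfectMatching {V E : Type*} (G : Graph V E) (M : Set E) : Prop :=
  M ⊆ E(G) ∧ ∀ v ∈ V(G), ∃! e, e ∈ M ∧ G.Inc e v

/-- `H` is an elementary subgraph of `G`: a subgraph of `G` which contains every vertex of `G` and
each of whose edges is used in some perfect matching of `H`. The edgeless spanning subgraph is
elementary. -/
structure IsElementary {V E : Type*} (H G : Graph V E) : Prop where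
  isSpanningSubgraph : H ≤s G
  exists_matching : ∀ e ∈ E(H), ∃ M : Set E, IsPerfectMatching H M ∧ e ∈ M

/-- The poset of elementary subgraphs of `G`, ordered by inclusion (`H ≤ H'` is Mathlib's
subgraph order on `Graph V E`). -/
abbrev ElementarySubgraph {V E : Type*} (G : Graph V E) : Type _ :=
  {H : Graph V E // IsElementary H G}

/-! ### Embedded graphs, plane graphs -/

/-- A graph (multiple edges allowed) embedded in an oriented closed surface, recorded by its
rotation system. Every edge `e` has two oppositely oriented darts `(e, true)` and `(e, false)`;
`tail d` is the vertex at which the dart `d` starts, and `rot d` is the dart that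
follows `d` in *counterclockwise* order among the darts starting at the same vertex. -/
structure EmbeddedGraph (V E : Type*) where
  tail : E × Bool → V
  rot : Equiv.Perm (E × Bool)
  sameCycle_rot_iff : ∀ d d' : E × Bool, rot.SameCycle d d' ↔ tail d = tail d'

namespace EmbeddedGraph

variable {V E : Type*} (G : EmbeddedGraph V E)

/-- The reversal of darts: same edge, opposite orientation. -/
def rev : Equiv.Perm (E × Bool) :=
  (Equiv.refl E).prodCongr Equiv.boolNot

/-- The vertex at which a dart ends. -/
def head (d : E × Bool) : V := G.tail (rev d)

/-- The underlying multigraph. -/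
def toGraph : Graph V E where
  vertexSet := Set.univ
  IsLink e x y := ∃ b : Bool, G.tail (e, b) = x ∧ G.head (e, b) = y
  edgeSet := Set.univ
  isLink_symm := by
    rintro e - 
    refine ⟨fun x y h => ?_⟩
    obtain ⟨b, rfl, rfl⟩ := h
    exact ⟨!b, rfl, by simp [head, rev]⟩
  eq_or_eq_of_isLink_of_isLink := by
    rintro e x y v w ⟨b, rfl, rfl⟩ ⟨c, rfl, rfl⟩
    cases b <;> cases c <;> simp [head, rev]
  edge_mem_iff_exists_isLink := by
    intro e
    exact ⟨fun _ => ⟨_, _, true, rfl, rfl⟩, fun _ => Set.mem_univ e⟩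
  left_mem_of_isLink := fun _ _ _ _ => Set.mem_univ _

/-- The permutation of the darts that walks around the faces: the successor of a dart `d = (u → v)`
is the dart that follows `v → u` counterclockwise around `v`. Thus the face being
traversed always lies immediately to the *right* of `d`; in particular bounded faces are traversed
clockwise. -/
def facePerm : Equiv.Perm (E × Bool) := rev.trans G.rot

/-- The faces: the orbits of darts under `facePerm`. -/
def Face : Type _ := Quotient (Equiv.Perm.SameCycle.setoid G.facePerm)

/-- The face lying to the right of a dart. -/
def faceOf (d : E × Bool) : G.Face :=
  Quotient.mk (Equiv.Perm.SameCycle.setoid G.facePerm) d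

/-- The boundary of `f` is a cycle: walking once around `f` one meets no vertex and no edge
twice. -/
def BoundaryIsCycle (f : G.Face) : Prop :=
  ∀ d d' : E × Bool, G.faceOf d = f → G.faceOf d' = f →
    (G.tail d = G.tail d' ∨ d.1 = d'.1) → d = d'

end EmbeddedGraph

/-- A finite connected plane graph (with at least one edge), up to orientation preserving
homeomorphism of the plane: a finite connected graph embedded in a surface of
Euler characteristic `|V| - |E| + |F| = 2`, i.e. in the sphere, together with the choice of the
face which contains the point at infinity. -/
structure PlaneGraph (V E : Type*) extends EmbeddedGraph V E where
  finite_vertices : Finite V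
  finite_edges : Finite E
  connected : ∀ x y : V, Relation.ReflTransGen toEmbeddedGraph.toGraph.Adj x y
  euler : Nat.card V + Nat.card toEmbeddedGraph.Face = Nat.card E + 2
  infiniteFace : toEmbeddedGraph.Face

/-- A finite connected bipartite plane graph with a fixed proper coloring of its vertices:
the vertices in `black` are black, the others are white. -/
structure BipartitePlaneGraph (V E : Type*) extends PlaneGraph V E where
  black : Set V
  proper : ∀ d : E × Bool, toEmbeddedGraph.tail d ∈ black ↔ toEmbeddedGraph.head d ∉ black

namespace BipartitePlaneGraph

variable {V E : Type*} (G : BipartitePlaneGraph V E)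

/-- Property (*): every edge of the finite connected bipartite plane graph `G` is in some perfect
matching. -/
def PropertyStar : Prop :=
  ∀ e : E, ∃ M : Set E, IsPerfectMatching G.toGraph M ∧ e ∈ M

/-- The non-infinite faces of `G`. -/
def BoundedFace : Type _ := {f : G.Face // f ≠ G.infiniteFace}

/-- The black-white edges of a bounded face `f`: the edges in the boundary of `f` for which, going
around `f` clockwise, one sees first the black and then the white vertex. -/
def blackWhite (f : G.BoundedFace) : Set E :=
  {e | ∃ d : E × Bool, d.1 = e ∧ G.faceOf d = f.1 ∧ G.tail d ∈ G.black}

/-- The white-black edges of a bounded face `f`. -/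
def whiteBlack (f : G.BoundedFace) : Set E :=
  {e | ∃ d : E × Bool, d.1 = e ∧ G.faceOf d = f.1 ∧ G.tail d ∉ G.black}

/-- The dimers (perfect matchings) of `G`. -/
@[ext]
structure Dimer where
  edges : Set E
  isPerfectMatching : IsPerfectMatching G.toGraph edges

variable {G}

/-- `M` is obtained from `M'` by the down-flip at `f`: the boundary of `f` is a cycle, `M'` contains
all black-white edges of `f`, and `M` arises from `M'` by replacing them with the white-black
edges of `f`. -/
structure DownFlip (f : G.BoundedFace) (M' M : G.Dimer) : Prop where
  boundaryIsCycle : G.BoundaryIsCycle f.1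
  blackWhite_subset : G.blackWhite f ⊆ M'.edges
  edges_eq : M.edges = (M'.edges \ G.blackWhite f) ∪ G.whiteBlack f

/-- The order of the dimer lattice: `M ≤ M'` if `M` is obtained from `M'` by applying a sequence of
down-flips. -/
instance : Preorder G.Dimer where
  le M M' := Relation.ReflTransGen (fun A B => ∃ f, DownFlip f A B) M' M
  le_refl _ := Relation.ReflTransGen.refl
  le_trans _ _ _ h h' := h'.trans h

/-- `SaturatedChain M₀ M w`: there is a saturated chain `M₀ ⋖ M₁ ⋖ ⋯ ⋖ M_ℓ = M` of dimers in which
`M_{i-1}, M_i` are related by a flip at a face `f_i`, and whose weight `y_{f_1} ⋯ y_{f_ℓ}` is the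
monomial with exponent vector `w`. -/
inductive SaturatedChain (M₀ : G.Dimer) : G.Dimer → (G.BoundedFace →₀ ℕ) → Prop
  | nil : SaturatedChain M₀ M₀ 0
  | snoc {M M' : G.Dimer} {w : G.BoundedFace →₀ ℕ} (f : G.BoundedFace) :
      SaturatedChain M₀ M w → M ⋖ M' → DownFlip f M' M →
      SaturatedChain M₀ M' (w + Finsupp.single f 1)

open Classical in
/-- The exponent vector of the multivariate rank of a dimer `M`: the weight of any saturated chain
from the minimal dimer to `M`. (For graphs with property (*) such a chain exists and its weight does
not depend on the choice; the value `0` is used if there is no such chain.) -/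
def multivariateRank (M : G.Dimer) : G.BoundedFace →₀ ℕ :=
  if h : ∃ w : G.BoundedFace →₀ ℕ, ∃ M₀ : G.Dimer, IsBot M₀ ∧ SaturatedChain M₀ M w then
    h.choose
  else 0

variable (G)

/-- The dimer face polynomial `D_G`, the sum of the multivariate ranks of all (finitely many) dimers
of `G`. -/
def dimerFacePolynomial : MvPolynomial G.BoundedFace ℤ :=
  ∑ᶠ M : G.Dimer, MvPolynomial.monomial (multivariateRank M) 1

end BipartitePlaneGraph

/-! ### Newton polytopes and face lattices -/

/-- The Newton polytope of a polynomial: the convex hull of the exponent vectors of its monomials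
with nonzero coefficient. -/
def newtonPolytope {I R : Type*} [CommSemiring R] (p : MvPolynomial I R) : Set (I → ℝ) :=
  convexHull ℝ ((fun (m : I →₀ ℕ) (i : I) => (m i : ℝ)) '' (p.support : Set (I →₀ ℕ)))

/-- The face lattice of a polytope `P`, ordered by inclusion. A face is the set of maximizers in `P`
of a linear functional, or empty; `P` itself is a face. -/
abbrev FaceLattice {I : Type*} (P : Set (I → ℝ)) : Type _ :=
  {F : Set (I → ℝ) // IsExposed ℝ P F}

end DimerNewton

end

/-! The Newton polytope is an affine copy of the perfect matching polytope, and the faces of the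
latter are read off from the edges that they use.

Two dimers differ by a flow, directed from black to white, with zero net flow at every vertex. On a
sphere such a flow is the jump across edges of a function on the faces; normalised to vanish at the
infinite face it is integral and unique, and is called the height (`exists_face_potential`,
`Dimer.exists_height`). A down-flip at `f` lowers the height by one at `f` and nowhere else
(`DownFlip.height_eq`). Property (*) guarantees that a dimer which is somewhere higher than another
can be flipped down at such a place (`PropertyStar.exists_downFlip_of_height_pos`). Hence a minimum
exists, and the exponent vector of `mrk(M)` is the height of `M` above it. Taking jumps across edges
and adding the indicator of the minimum is therefore an injective affine map sending the exponent
vector of `M` to the indicator of `M` (`PropertyStar.indicatorFamily`).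

Let a functional have maximum `α` over the dimers, attained by the `k` dimers of a nonempty face,
and let `M` be a dimer contained in their union. Their sum minus `M` is a nonnegative edge weight of
degree `k - 1` at every vertex. By Hall's theorem it is a sum of `k - 1` dimers, so its value is at
most `(k - 1) α`; thus `M` has value at least `α` and lies on the face. So a face is determined by
the union of its dimers. Conversely, the vanishing of the coordinates outside an edge set cuts out a
face. This matches faces with unions of dimers, which are the edge sets of elementary subgraphs. -/

open scoped Graph

noncomputable section

namespace DimerNewton

/-! ### Darts, rotations and faces -/

namespace EmbeddedGraph

variable {V E : Type*} (G : EmbeddedGraph V E)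

@[simp] lemma rev_mk (e : E) (b : Bool) : rev (e, b) = (e, !b) := rfl

@[simp] lemma rev_fst (d : E × Bool) : (rev d).1 = d.1 := rfl

@[simp] lemma rev_rev (d : E × Bool) : rev (rev d) = d := by
  obtain ⟨e, b⟩ := d
  simp

lemma eq_or_eq_rev {d d' : E × Bool} (h : d.1 = d'.1) : d = d' ∨ d = rev d' := by
  obtain ⟨e, b⟩ := d
  obtain ⟨e', b'⟩ := d'
  obtain rfl : e = e' := h
  cases b <;> cases b' <;> simp

@[simp] lemma head_rev (d : E × Bool) : G.head (rev d) = G.tail d := by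
  simp [head]

lemma tail_rev (d : E × Bool) : G.tail (rev d) = G.head d := rfl

@[simp] lemma tail_rot (d : E × Bool) : G.tail (G.rot d) = G.tail d :=
  (G.sameCycle_rot_iff _ _).1 (Equiv.Perm.SameCycle.refl _ _).apply_left

lemma facePerm_apply (d : E × Bool) : G.facePerm d = G.rot (rev d) := rfl

@[simp] lemma tail_facePerm (d : E × Bool) : G.tail (G.facePerm d) = G.head d := by
  rw [facePerm_apply, tail_rot, tail_rev]

@[simp] lemma faceOf_facePerm (d : E × Bool) : G.faceOf (G.facePerm d) = G.faceOf d :=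
  Quotient.sound (Equiv.Perm.SameCycle.refl _ _).apply_left

/-- Since `facePerm (rev d) = rot d`, one turn around a vertex amounts to crossing one edge. -/
lemma faceOf_rot (d : E × Bool) : G.faceOf (G.rot d) = G.faceOf (rev d) := by
  rw [← G.faceOf_facePerm (rev d), facePerm_apply, rev_rev]

lemma faceOf_surjective : Function.Surjective G.faceOf := Quotient.exists_rep

lemma exists_faceOf_eq_head_eq (d : E × Bool) :
    ∃ d', G.faceOf d' = G.faceOf d ∧ G.head d' = G.tail d := by
  refine ⟨G.facePerm.symm d, ?_, ?_⟩
  · rw [← G.faceOf_facePerm (G.facePerm.symm d), Equiv.apply_symm_apply]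
  · rw [← G.tail_facePerm (G.facePerm.symm d), Equiv.apply_symm_apply]

lemma toGraph_inc_iff {e : E} {v : V} : G.toGraph.Inc e v ↔ ∃ b, G.tail (e, b) = v := by
  constructor
  · rintro ⟨y, b, h, -⟩
    exact ⟨b, h⟩
  · rintro ⟨b, h⟩
    exact ⟨_, b, h, rfl⟩

end EmbeddedGraph

/-! ### Exactness of the face coboundary on the sphere -/

namespace PlaneGraph

open EmbeddedGraph

variable {V E : Type*} (G : PlaneGraph V E)

instance : Finite G.Face := by
  have := G.finite_edges
  exact Quotient.finite _

lemma vertex_induction {P : V → Prop} (x : V) (hx : P x)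
    (step : ∀ d : E × Bool, P (G.tail d) → P (G.head d)) (y : V) : P y := by
  induction G.connected x y with
  | refl => exact hx
  | tail _ h ih =>
    obtain ⟨e, b, rfl, rfl⟩ := h
    exact step _ ih

/-- The faces of a connected plane graph are connected across edges. -/
lemma face_induction {P : G.Face → Prop} (f₀ : G.Face) (h₀ : P f₀)
    (step : ∀ d : E × Bool, P (G.faceOf d) → P (G.faceOf (rev d))) (f : G.Face) : P f := by
  have step' : ∀ d, P (G.faceOf d) ↔ P (G.faceOf (rev d)) := fun d =>
    ⟨step d, fun h => by simpa using step _ h⟩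
  have hrot : ∀ d, P (G.faceOf (G.rot d)) ↔ P (G.faceOf d) := fun d => by
    rw [faceOf_rot, ← step']
  have hfin := G.finite_edges
  -- Rotation carries `P` to all the faces around a vertex; connectedness of the graph then carries
  -- it from vertex to vertex.
  have htail : ∀ d d', G.tail d = G.tail d' → P (G.faceOf d) → P (G.faceOf d') := by
    intro d d' h hd
    obtain ⟨n, -, rfl⟩ := ((G.sameCycle_rot_iff d d').2 h).exists_pow_eq'
    clear h
    induction n with
    | zero => simpa using hd
    | succ n ih => rwa [pow_succ', Equiv.Perm.mul_apply, hrot]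
  obtain ⟨d₀, rfl⟩ := G.faceOf_surjective f₀
  obtain ⟨d, rfl⟩ := G.faceOf_surjective f
  refine G.vertex_induction (P := fun v => ∀ d, G.tail d = v → P (G.faceOf d)) (G.tail d₀)
    (fun d hd => htail d₀ d hd.symm h₀) ?_ (G.tail d) d rfl
  intro d hd d' hd'
  exact htail (rev d) d' hd'.symm (step _ (hd d rfl))

/-- The coboundary of a function on the vertices. -/
def vertexCoboundary : (V → ℝ) →ₗ[ℝ] (E → ℝ) where
  toFun p e := p (G.tail (e, true)) - p (G.tail (e, false))
  map_add' p q := by ext e; simp; ring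
  map_smul' c p := by ext e; simp; ring

/-- The coboundary of a function on the faces. -/
def faceCoboundary : (G.Face → ℝ) →ₗ[ℝ] (E → ℝ) where
  toFun h e := h (G.faceOf (e, true)) - h (G.faceOf (e, false))
  map_add' p q := by ext e; simp; ring
  map_smul' c p := by ext e; simp; ring

lemma finrank_ker_vertexCoboundary_le :
    Module.finrank ℝ (LinearMap.ker G.vertexCoboundary) ≤ 1 := by
  have h1 : (1 : V → ℝ) ∈ LinearMap.ker G.vertexCoboundary := by
    ext e; simp [vertexCoboundary]
  refine finrank_le_one (⟨1, h1⟩ : LinearMap.ker G.vertexCoboundary) ?_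
  rintro ⟨p, hp⟩
  obtain ⟨d₀, -⟩ := G.faceOf_surjective G.infiniteFace
  refine ⟨p (G.tail d₀), Subtype.ext ?_⟩
  ext v
  have := G.vertex_induction (P := fun v => p v = p (G.tail d₀)) (G.tail d₀) rfl ?_ v
  · simpa using this.symm
  · rintro ⟨e, b⟩ h
    have := congrFun hp e
    simp only [vertexCoboundary, LinearMap.coe_mk, AddHom.coe_mk, Pi.zero_apply] at this
    rw [← h]
    cases b <;> simp only [head, rev_mk, Bool.not_true, Bool.not_false] <;> linarith

lemma finrank_ker_faceCoboundary_le :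
    Module.finrank ℝ (LinearMap.ker G.faceCoboundary) ≤ 1 := by
  have h1 : (1 : G.Face → ℝ) ∈ LinearMap.ker G.faceCoboundary := by
    ext e; simp [faceCoboundary]
  refine finrank_le_one (⟨1, h1⟩ : LinearMap.ker G.faceCoboundary) ?_
  rintro ⟨p, hp⟩
  refine ⟨p G.infiniteFace, Subtype.ext ?_⟩
  ext v
  have := G.face_induction (P := fun v => p v = p G.infiniteFace) G.infiniteFace rfl ?_ v
  · simpa using this.symm
  · rintro ⟨e, b⟩ h
    have := congrFun hp e
    simp only [faceCoboundary, LinearMap.coe_mk, AddHom.coe_mk, Pi.zero_apply] at this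
    rw [← h]
    cases b <;> simp only [rev_mk, Bool.not_true, Bool.not_false] <;> linarith

lemma sum_antisymm_mul [Fintype E] (θ p : E × Bool → ℝ) (hθ : ∀ d, θ (rev d) = -θ d) :
    ∑ e, θ (e, true) * (p (e, true) - p (e, false)) = ∑ d, θ d * p d := by
  rw [Fintype.sum_prod_type]
  refine Finset.sum_congr rfl fun e _ => ?_
  have := hθ (e, true)
  simp only [rev_mk, Bool.not_true] at this
  rw [Fintype.sum_bool, this]
  ring

/-- In the sum over darts, reindexing by `rot` fixes the tails and turns the faces to the right of
darts into the faces to their left, so the two halves cancel. -/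
lemma coboundary_orthogonal [Fintype E] (p : V → ℝ) (h : G.Face → ℝ) :
    ∑ e, G.faceCoboundary h e * G.vertexCoboundary p e = 0 := by
  have := sum_antisymm_mul (fun d : E × Bool => h (G.faceOf d) - h (G.faceOf (rev d)))
    (fun d => p (G.tail d)) (fun d => by simp)
  refine (this.trans ?_ : _)
  simp only [sub_mul, Finset.sum_sub_distrib]
  rw [sub_eq_zero, ← Equiv.sum_comp G.rot]
  simp [faceOf_rot]

/-- A plane graph has no cohomology: a function on the darts that is antisymmetric and sums to zero
around each vertex is the coboundary of a function on the faces. -/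
theorem exists_face_potential [Fintype E] (θ : E × Bool → ℝ) (hθ : ∀ d, θ (rev d) = -θ d)
    (hsum : ∀ p : V → ℝ, ∑ d, θ d * p (G.tail d) = 0) :
    ∃ h : G.Face → ℝ, ∀ d, h (G.faceOf d) - h (G.faceOf (rev d)) = θ d := by
  classical
  have := G.finite_vertices
  have := Fintype.ofFinite V
  have := Fintype.ofFinite G.Face
  let B := LinearMap.toMatrix' G.vertexCoboundary
  have hB : B.mulVecLin = G.vertexCoboundary := Matrix.toLin'_toMatrix' _
  have hker : ∀ c : E → ℝ, c ∈ LinearMap.ker B.transpose.mulVecLin ↔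
      ∀ p, ∑ e, c e * G.vertexCoboundary p e = 0 := by
    intro c
    have : ∀ p, ∑ e, c e * G.vertexCoboundary p e = B.transpose.mulVec c ⬝ᵥ p := by
      intro p
      rw [Matrix.mulVec_transpose, ← Matrix.dotProduct_mulVec, ← Matrix.mulVecLin_apply, hB]
      rfl
    simp_rw [this, LinearMap.mem_ker, Matrix.mulVecLin_apply, dotProduct_eq_zero_iff]
  have hle : LinearMap.range G.faceCoboundary ≤ LinearMap.ker B.transpose.mulVecLin := by
    rintro _ ⟨h, rfl⟩
    exact (hker _).2 fun p => G.coboundary_orthogonal p h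
  have hrank : Module.finrank ℝ (LinearMap.range B.transpose.mulVecLin) =
      Module.finrank ℝ (LinearMap.range G.vertexCoboundary) := by
    rw [← hB]
    exact Matrix.rank_transpose B
  have e1 := G.vertexCoboundary.finrank_range_add_finrank_ker
  have e2 := G.faceCoboundary.finrank_range_add_finrank_ker
  have e3 := B.transpose.mulVecLin.finrank_range_add_finrank_ker
  have e4 := G.finrank_ker_vertexCoboundary_le
  have e5 := G.finrank_ker_faceCoboundary_le
  have e6 := G.euler
  simp only [Module.finrank_fintype_fun_eq_card, Nat.card_eq_fintype_card] at e1 e2 e3 e6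
  -- The kernels have dimension at most one, so the flow space has dimension at most `|E| - |V| +
  -- 1`, while the face coboundaries have dimension at least `|F| - 1`. Euler's formula makes these
  -- two numbers equal.
  have heq := Submodule.eq_of_le_of_finrank_le hle (by omega)
  have hmem : (fun e => θ (e, true)) ∈ LinearMap.ker B.transpose.mulVecLin := by
    refine (hker _).2 fun p => ?_
    rw [← hsum p]
    exact sum_antisymm_mul θ (fun d => p (G.tail d)) hθ
  rw [← heq] at hmem
  obtain ⟨h, hh⟩ := hmem
  refine ⟨h, ?_⟩
  rintro ⟨e, b⟩
  have h1 := congrFun hh e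
  have h2 := hθ (e, true)
  simp only [faceCoboundary, LinearMap.coe_mk, AddHom.coe_mk, rev_mk, Bool.not_true] at h1 h2
  cases b <;> simp only [rev_mk, Bool.not_true, Bool.not_false] <;> linarith

end PlaneGraph

/-! ### Dimers and their heights -/

namespace BipartitePlaneGraph

open EmbeddedGraph

variable {V E : Type*} {G : BipartitePlaneGraph V E}

lemma tail_rev_mem_black_iff (d : E × Bool) : G.tail (rev d) ∈ G.black ↔ G.tail d ∉ G.black := by
  rw [tail_rev, G.proper d, not_not]

lemma dart_eq_of_fst_eq {d d' : E × Bool} (h : d.1 = d'.1)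
    (hc : G.tail d ∈ G.black ↔ G.tail d' ∈ G.black) : d = d' := by
  rcases eq_or_eq_rev h with h | h
  · exact h
  · subst h
    rw [tail_rev_mem_black_iff] at hc
    tauto

lemma exists_black_dart (G : BipartitePlaneGraph V E) (e : E) :
    ∃ d : E × Bool, d.1 = e ∧ G.tail d ∈ G.black := by
  by_cases h : G.tail (e, true) ∈ G.black
  · exact ⟨_, rfl, h⟩
  · exact ⟨rev (e, true), rfl, (tail_rev_mem_black_iff _).2 h⟩

lemma isPerfectMatching_iff {S : Set E} :
    IsPerfectMatching G.toGraph S ↔ ∀ v, ∃! d : E × Bool, G.tail d = v ∧ d.1 ∈ S := by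
  constructor
  · rintro ⟨-, h⟩ v
    obtain ⟨e, ⟨he, hv⟩, huniq⟩ := h v (Set.mem_univ v)
    obtain ⟨b, hb⟩ := G.toGraph_inc_iff.1 hv
    refine ⟨(e, b), ⟨hb, he⟩, ?_⟩
    rintro d ⟨hd, hdS⟩
    have : d.1 = e := huniq _ ⟨hdS, G.toGraph_inc_iff.2 ⟨d.2, hd⟩⟩
    exact dart_eq_of_fst_eq this (by rw [hd, hb])
  · intro h
    refine ⟨fun e _ => Set.mem_univ e, fun v _ => ?_⟩
    obtain ⟨d, ⟨hd, hdS⟩, huniq⟩ := h v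
    refine ⟨d.1, ⟨hdS, G.toGraph_inc_iff.2 ⟨d.2, hd⟩⟩, ?_⟩
    rintro e ⟨he, hv⟩
    obtain ⟨b, hb⟩ := G.toGraph_inc_iff.1 hv
    rw [← huniq (e, b) ⟨hb, he⟩]

namespace Dimer

lemma existsUnique_dart (M : G.Dimer) (v : V) :
    ∃! d : E × Bool, G.tail d = v ∧ d.1 ∈ M.edges :=
  isPerfectMatching_iff.1 M.isPerfectMatching v

lemma dart_eq_of_tail_eq (M : G.Dimer) {d d' : E × Bool} (h : G.tail d = G.tail d')
    (hd : d.1 ∈ M.edges) (hd' : d'.1 ∈ M.edges) : d = d' :=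
  (M.existsUnique_dart (G.tail d')).unique ⟨h, hd⟩ ⟨rfl, hd'⟩

lemma dart_eq_of_head_eq (M : G.Dimer) {d d' : E × Bool} (h : G.head d = G.head d')
    (hd : d.1 ∈ M.edges) (hd' : d'.1 ∈ M.edges) : d = d' :=
  (rev).injective (M.dart_eq_of_tail_eq (d := rev d) (d' := rev d') h hd hd')

instance : Finite G.Dimer := by
  have := G.finite_edges
  exact Finite.of_injective (fun M : G.Dimer => M.edges) fun _ _ => Dimer.ext

lemma edges_nonempty (M : G.Dimer) : M.edges.Nonempty := by
  obtain ⟨d, -⟩ := G.faceOf_surjective G.infiniteFace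
  obtain ⟨d', h, -⟩ := M.existsUnique_dart (G.tail d)
  exact ⟨_, h.2⟩

/-- The indicator function of a dimer. -/
def ind (M : G.Dimer) : E → ℤ := M.edges.indicator 1

lemma ind_of_mem {M : G.Dimer} {e : E} (h : e ∈ M.edges) : M.ind e = 1 := by
  simp [ind, h]

lemma ind_of_notMem {M : G.Dimer} {e : E} (h : e ∉ M.edges) : M.ind e = 0 := by
  simp [ind, h]

lemma ind_nonneg (M : G.Dimer) (e : E) : 0 ≤ M.ind e := by
  by_cases h : e ∈ M.edges
  · simp [ind_of_mem h]
  · simp [ind_of_notMem h]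

lemma mem_edges_iff_ind (M : G.Dimer) (e : E) : e ∈ M.edges ↔ M.ind e = 1 := by
  by_cases h : e ∈ M.edges
  · simp [ind_of_mem h, h]
  · simp [ind_of_notMem h, h]

lemma ext_ind {M M' : G.Dimer} (h : ∀ e, M.ind e = M'.ind e) : M = M' := by
  ext e
  rw [mem_edges_iff_ind, mem_edges_iff_ind, h]

lemma sum_ind_tail [Fintype E] (M : G.Dimer) (v : V)
    [DecidablePred fun d : E × Bool => G.tail d = v] :
    ∑ d : E × Bool with G.tail d = v, M.ind d.1 = 1 := by
  obtain ⟨d, ⟨hd, hdM⟩, huniq⟩ := M.existsUnique_dart v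
  rw [Finset.sum_eq_single_of_mem d (by simpa using hd), ind_of_mem hdM]
  intro d' hd' hne
  refine ind_of_notMem fun h => hne (huniq d' ⟨by simpa using hd', h⟩)

/-- Two dimers differ by the coboundary of an integral function on the faces. -/
lemma exists_height (M M' : G.Dimer) : ∃ h : G.Face → ℤ, h G.infiniteFace = 0 ∧
    ∀ d, G.tail d ∈ G.black →
      h (G.faceOf d) - h (G.faceOf (rev d)) = M.ind d.1 - M'.ind d.1 := by
  classical
  have := G.finite_edges
  have := Fintype.ofFinite E
  have := G.finite_vertices
  have := Fintype.ofFinite V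
  -- The sign makes the difference of indicators antisymmetric under `rev`; its sums at vertices
  -- vanish because both dimers have one edge there.
  let s : V → ℝ := fun v => if v ∈ G.black then 1 else -1
  obtain ⟨h, hh⟩ := G.exists_face_potential
    (fun d => s (G.tail d) * ((M.ind d.1 - M'.ind d.1 : ℤ) : ℝ)) (by
      intro d
      by_cases hd : G.tail d ∈ G.black
      · have : G.tail (rev d) ∉ G.black := fun h' => (tail_rev_mem_black_iff d).1 h' hd
        simp [s, hd, this]
      · have := (tail_rev_mem_black_iff d).2 hd
        simp [s, hd, this]) (by
      intro p
      rw [← Finset.sum_fiberwise Finset.univ G.tail]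
      refine Finset.sum_eq_zero fun v _ => ?_
      have e1 : ∑ d : E × Bool with G.tail d = v, (M.ind d.1 - M'.ind d.1) = 0 := by
        rw [Finset.sum_sub_distrib, M.sum_ind_tail v, M'.sum_ind_tail v, sub_self]
      have e2 : ∑ d : E × Bool with G.tail d = v, ((M.ind d.1 - M'.ind d.1 : ℤ) : ℝ) = 0 := by
        rw [← Int.cast_sum, e1, Int.cast_zero]
      rw [← mul_zero (s v * p v), ← e2, Finset.mul_sum]
      refine Finset.sum_congr rfl fun d hd => ?_
      rw [(Finset.mem_filter.1 hd).2]
      ring)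
  -- The real potential has integral jumps, so it is integral once normalised at the infinite face.
  have hint : ∀ f, ∃ n : ℤ, h f - h G.infiniteFace = n := by
    refine G.face_induction G.infiniteFace ⟨0, by simp⟩ ?_
    rintro d ⟨n, hn⟩
    have := hh d
    by_cases hd : G.tail d ∈ G.black
    · refine ⟨n - (M.ind d.1 - M'.ind d.1), ?_⟩
      simp only [s, hd, if_true] at this
      push_cast at this ⊢
      linarith
    · refine ⟨n + (M.ind d.1 - M'.ind d.1), ?_⟩
      simp only [s, hd, if_false] at this
      push_cast at this ⊢
      linarith
  choose k hk using hint
  refine ⟨k, ?_, fun d hd => ?_⟩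
  · have := hk G.infiniteFace
    simpa using this.symm
  · have := hh d
    simp only [s, hd, if_true, one_mul] at this
    have h1 := hk (G.faceOf d)
    have h2 := hk (G.faceOf (rev d))
    have : ((k (G.faceOf d) - k (G.faceOf (rev d)) : ℤ) : ℝ) =
        ((M.ind d.1 - M'.ind d.1 : ℤ) : ℝ) := by
      rw [← this]
      push_cast
      linarith
    exact_mod_cast this

/-- The height of `M` relative to `M'`. -/
def height (M M' : G.Dimer) : G.Face → ℤ := (exists_height M M').choose

@[simp] lemma height_infiniteFace (M M' : G.Dimer) : M.height M' G.infiniteFace = 0 :=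
  (exists_height M M').choose_spec.1

lemma height_sub (M M' : G.Dimer) {d : E × Bool} (hd : G.tail d ∈ G.black) :
    M.height M' (G.faceOf d) - M.height M' (G.faceOf (rev d)) = M.ind d.1 - M'.ind d.1 :=
  (exists_height M M').choose_spec.2 d hd

lemma eq_height {M M' : G.Dimer} {h : G.Face → ℤ} (h0 : h G.infiniteFace = 0)
    (hd : ∀ d, G.tail d ∈ G.black →
      h (G.faceOf d) - h (G.faceOf (rev d)) = M.ind d.1 - M'.ind d.1) :
    M.height M' = h := by
  funext f
  refine G.face_induction (P := fun f => M.height M' f = h f) G.infiniteFace (by simp [h0]) ?_ f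
  intro d hf
  by_cases hb : G.tail d ∈ G.black
  · have h1 := hd d hb
    have h2 := M.height_sub M' hb
    omega
  · have hb' := (tail_rev_mem_black_iff d).2 hb
    have h1 := hd _ hb'
    have h2 := M.height_sub M' hb'
    rw [rev_rev] at h1 h2
    omega

lemma height_add (M M' M'' : G.Dimer) : M.height M'' = M.height M' + M'.height M'' := by
  refine eq_height (by simp) fun d hd => ?_
  have h1 := M.height_sub M' hd
  have h2 := M'.height_sub M'' hd
  simp only [Pi.add_apply]
  omega

lemma height_self (M : G.Dimer) : M.height M = 0 :=
  eq_height (by simp) (by simp)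

lemma height_comm (M M' : G.Dimer) : M.height M' = - M'.height M := by
  rw [eq_neg_iff_add_eq_zero, ← height_add, height_self]

lemma eq_of_height_eq_zero {M M' : G.Dimer} (h : M.height M' = 0) : M = M' := by
  refine ext_ind fun e => ?_
  obtain ⟨d, rfl, hd⟩ := G.exists_black_dart e
  have := M.height_sub M' hd
  rw [h] at this
  simp only [Pi.zero_apply] at this
  omega

end Dimer

/-! ### Down-flips and their effect on heights -/

open Classical in
lemma DownFlip.height_eq {f : G.BoundedFace} {M' M : G.Dimer} (h : DownFlip f M' M) :
    M'.height M = Pi.single f.1 1 := by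
  refine Dimer.eq_height (by simp [f.2.symm]) fun d hd => ?_
  have hrev : G.tail (rev d) ∉ G.black := fun h => (tail_rev_mem_black_iff d).1 h hd
  have hbw : d.1 ∈ G.blackWhite f ↔ G.faceOf d = f.1 := by
    constructor
    · rintro ⟨d', h1, h2, h3⟩
      rwa [← dart_eq_of_fst_eq (d := d') (d' := d) h1 (by tauto)]
    · exact fun h => ⟨d, rfl, h, hd⟩
  have hwb : d.1 ∈ G.whiteBlack f ↔ G.faceOf (rev d) = f.1 := by
    constructor
    · rintro ⟨d', h1, h2, h3⟩
      rwa [← dart_eq_of_fst_eq (d := d') (d' := rev d) h1 (by tauto)]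
    · exact fun h => ⟨rev d, rfl, h, hrev⟩
  have hne : rev d ≠ d := fun h => hrev (by rwa [h])
  have hmem : d.1 ∈ M.edges ↔ (d.1 ∈ M'.edges ∧ G.faceOf d ≠ f.1) ∨ G.faceOf (rev d) = f.1 := by
    rw [h.edges_eq, Set.mem_union, Set.mem_sdiff, hbw, hwb]
  by_cases h1 : G.faceOf d = f.1
  · have h2 : G.faceOf (rev d) ≠ f.1 := fun h2 => hne (h.boundaryIsCycle _ _ h2 h1 (Or.inr rfl))
    rw [Dimer.ind_of_mem (h.blackWhite_subset (hbw.2 h1)), Dimer.ind_of_notMem (by tauto), h1,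
      Pi.single_eq_same, Pi.single_eq_of_ne h2]
  · by_cases h2 : G.faceOf (rev d) = f.1
    · have h3 : d.1 ∉ M'.edges := by
        intro h3
        obtain ⟨d', hf', hh'⟩ := G.exists_faceOf_eq_head_eq (rev d)
        have hb' : G.tail d' ∈ G.black := by
          rw [G.proper, hh']
          exact hrev
        have h4 := h.blackWhite_subset ⟨d', rfl, hf'.trans h2, hb'⟩
        have := M'.dart_eq_of_head_eq (hh'.trans rfl : _ = G.head d) h4 h3
        subst this
        exact h1 (hf'.trans h2)
      rw [Dimer.ind_of_notMem h3, Dimer.ind_of_mem (by tauto), h2,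
        Pi.single_eq_same, Pi.single_eq_of_ne h1]
    · rw [Pi.single_eq_of_ne h1, Pi.single_eq_of_ne h2]
      have : d.1 ∈ M.edges ↔ d.1 ∈ M'.edges := by tauto
      by_cases h3 : d.1 ∈ M'.edges
      · rw [Dimer.ind_of_mem h3, Dimer.ind_of_mem (this.2 h3)]; simp
      · rw [Dimer.ind_of_notMem h3, Dimer.ind_of_notMem (by tauto)]

/-- A bounded face whose black-white edges all belong to a dimer is bounded by a cycle. -/
lemma boundaryIsCycle_of_blackWhite_subset {f : G.BoundedFace} {M : G.Dimer}
    (h : G.blackWhite f ⊆ M.edges) : G.BoundaryIsCycle f.1 := by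
  have hblack : ∀ d, G.faceOf d = f.1 → G.tail d ∈ G.black → d.1 ∈ M.edges :=
    fun d h1 h2 => h ⟨d, rfl, h1, h2⟩
  -- Darts of `f` leaving a black vertex lie in `M`, as do the darts of `f` entering a white vertex;
  -- `M` has only one edge there.
  have htail : ∀ d d', G.faceOf d = f.1 → G.faceOf d' = f.1 → G.tail d = G.tail d' → d = d' := by
    intro d d' h1 h2 h3
    by_cases hb : G.tail d ∈ G.black
    · exact M.dart_eq_of_tail_eq h3 (hblack d h1 hb) (hblack d' h2 (h3 ▸ hb))
    · have key : ∀ a, G.faceOf a = f.1 → G.tail a ∉ G.black →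
          (G.facePerm.symm a).1 ∈ M.edges ∧ G.head (G.facePerm.symm a) = G.tail a := by
        intro a ha hab
        have e1 : G.head (G.facePerm.symm a) = G.tail a := by
          rw [← G.tail_facePerm, Equiv.apply_symm_apply]
        refine ⟨hblack _ ?_ ?_, e1⟩
        · rw [← ha, ← G.faceOf_facePerm, Equiv.apply_symm_apply]
        · rwa [G.proper, e1]
      obtain ⟨k1, k2⟩ := key d h1 hb
      obtain ⟨k3, k4⟩ := key d' h2 (h3 ▸ hb)
      exact G.facePerm.symm.injective
        (M.dart_eq_of_head_eq (k2.trans (h3.trans k4.symm)) k1 k3)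
  -- If `f` lies on both sides of an edge, both ends of that edge have degree one. Then `G` is a
  -- single edge, and its only face is the infinite one.
  have hedge : ∀ d, G.faceOf d = f.1 → G.faceOf (rev d) = f.1 → False := by
    intro d h1 h2
    have e1 : G.facePerm d = rev d :=
      htail _ _ ((G.faceOf_facePerm d).trans h1) h2 (G.tail_facePerm d)
    have e2 : G.facePerm (rev d) = d :=
      htail _ _ ((G.faceOf_facePerm _).trans h2) h1 (by rw [G.tail_facePerm, G.head_rev])
    rw [facePerm_apply] at e1
    rw [facePerm_apply, rev_rev] at e2
    have hrot : ∀ x y, (x = d ∨ x = rev d) → G.tail x = G.tail y → (y = d ∨ y = rev d) := by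
      intro x y hx hxy
      have hfin := G.finite_edges
      obtain ⟨n, -, rfl⟩ := ((G.sameCycle_rot_iff x y).2 hxy).exists_pow_eq'
      clear hxy
      induction n with
      | zero => simpa using hx
      | succ n ih =>
        rw [pow_succ', Equiv.Perm.mul_apply]
        rcases ih with ih | ih <;> rw [ih]
        · exact Or.inl e2
        · exact Or.inr e1
    have hall : ∀ v, ∀ y, G.tail y = v → y = d ∨ y = rev d := by
      refine fun v => G.vertex_induction (P := fun v => ∀ y, G.tail y = v → y = d ∨ y = rev d)
        (G.tail d) (fun y hy => hrot d y (Or.inl rfl) hy.symm) ?_ v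
      intro a ha y hy
      refine hrot (rev a) y ?_ hy.symm
      rcases ha a rfl with rfl | rfl
      · exact Or.inr rfl
      · exact Or.inl (rev_rev d)
    obtain ⟨a, ha⟩ := G.faceOf_surjective G.infiniteFace
    refine f.2 ?_
    rcases hall _ a rfl with rfl | rfl
    · exact h1.symm.trans ha
    · exact h2.symm.trans ha
  intro d d' h1 h2 h3
  rcases h3 with h3 | h3
  · exact htail d d' h1 h2 h3
  · rcases eq_or_eq_rev h3 with h4 | h4
    · exact h4
    · exact (hedge d' h2 (h4 ▸ h1)).elim

/-- Each vertex of the cycle `f` meets one black-white edge of `f`, which `M` uses, and one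
white-black edge, which replaces it. Vertices off `f` are unaffected. -/
lemma exists_downFlip {f : G.BoundedFace} {M : G.Dimer} (h : G.blackWhite f ⊆ M.edges) :
    ∃ M₂, DownFlip f M M₂ := by
  have hcyc := boundaryIsCycle_of_blackWhite_subset h
  have hwbmem : ∀ d, d.1 ∈ G.whiteBlack f →
      (G.tail d ∉ G.black ∧ G.faceOf d = f.1) ∨ (G.tail d ∈ G.black ∧ G.faceOf (rev d) = f.1) := by
    rintro d ⟨a, ha, haf, hab⟩
    rcases eq_or_eq_rev ha with rfl | rfl
    · exact Or.inl ⟨hab, haf⟩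
    · exact Or.inr ⟨by rw [tail_rev_mem_black_iff] at hab; tauto, haf⟩
  have hbwmem : ∀ d, d.1 ∈ G.blackWhite f →
      (G.tail d ∈ G.black ∧ G.faceOf d = f.1) ∨ (G.tail d ∉ G.black ∧ G.faceOf (rev d) = f.1) := by
    rintro d ⟨a, ha, haf, hab⟩
    rcases eq_or_eq_rev ha with rfl | rfl
    · exact Or.inl ⟨hab, haf⟩
    · exact Or.inr ⟨by rw [tail_rev_mem_black_iff] at hab; tauto, haf⟩
  have hrevface : ∀ d, G.faceOf (rev d) = f.1 →
      G.faceOf (G.facePerm (rev d)) = f.1 ∧ G.tail (G.facePerm (rev d)) = G.tail d := by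
    intro d hd
    exact ⟨by rw [faceOf_facePerm, hd], by rw [tail_facePerm, head_rev]⟩
  have hpm : IsPerfectMatching G.toGraph ((M.edges \ G.blackWhite f) ∪ G.whiteBlack f) := by
    rw [isPerfectMatching_iff]
    intro v
    by_cases hv : ∃ d, G.tail d = v ∧ G.faceOf d = f.1
    · obtain ⟨d, rfl, hdf⟩ := hv
      obtain ⟨d₁, hd₁f, hd₁h⟩ := G.exists_faceOf_eq_head_eq d
      have hd₁f := hd₁f.trans hdf
      have hM : ∀ a, G.tail a = G.tail d → a.1 ∈ M.edges → a.1 ∈ G.blackWhite f := by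
        intro a ha haM
        by_cases hb : G.tail d ∈ G.black
        · have hd : d.1 ∈ G.blackWhite f := ⟨d, rfl, hdf, hb⟩
          rwa [M.dart_eq_of_tail_eq ha haM (h hd)]
        · have hd : d₁.1 ∈ G.blackWhite f := ⟨d₁, rfl, hd₁f, by rwa [G.proper, hd₁h]⟩
          have := M.dart_eq_of_tail_eq (d := a) (d' := rev d₁)
            (by rw [ha, tail_rev, hd₁h]) haM (h hd)
          rw [this]
          exact hd
      by_cases hb : G.tail d ∈ G.black
      · refine ⟨rev d₁, ⟨hd₁h, Or.inr ⟨d₁, rfl, hd₁f, ?_⟩⟩, ?_⟩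
        · intro h'
          rw [G.proper, hd₁h] at h'
          exact h' hb
        · rintro a ⟨ha, ha' | ha'⟩
          · exact (ha'.2 (hM a ha ha'.1)).elim
          · rcases hwbmem a ha' with ⟨h1, -⟩ | ⟨-, h2⟩
            · exact (h1 (ha ▸ hb)).elim
            · have e1 := hcyc _ _ (hrevface a h2).1 hdf (Or.inl ((hrevface a h2).2.trans ha))
              have e2 : G.facePerm d₁ = d :=
                hcyc _ _ ((G.faceOf_facePerm _).trans hd₁f) hdf
                  (Or.inl ((G.tail_facePerm _).trans hd₁h))
              rw [← G.facePerm.injective (e1.trans e2.symm), rev_rev]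
      · refine ⟨d, ⟨rfl, Or.inr ⟨d, rfl, hdf, hb⟩⟩, ?_⟩
        rintro a ⟨ha, ha' | ha'⟩
        · exact (ha'.2 (hM a ha ha'.1)).elim
        · rcases hwbmem a ha' with ⟨-, h2⟩ | ⟨h1, -⟩
          · exact hcyc _ _ h2 hdf (Or.inl ha)
          · exact (hb (ha ▸ h1)).elim
    · push Not at hv
      have hnot : ∀ a, G.tail a = v → a.1 ∉ G.blackWhite f ∧ a.1 ∉ G.whiteBlack f := by
        intro a ha
        have h2 : G.faceOf (rev a) ≠ f.1 := fun h2 =>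
          hv _ ((hrevface a h2).2.trans ha) (hrevface a h2).1
        have h1 := hv a ha
        exact ⟨fun h' => by have := hbwmem a h'; tauto, fun h' => by have := hwbmem a h'; tauto⟩
      obtain ⟨d, ⟨hd, hdM⟩, huniq⟩ := M.existsUnique_dart v
      refine ⟨d, ⟨hd, Or.inl ⟨hdM, (hnot d hd).1⟩⟩, ?_⟩
      rintro a ⟨ha, ha' | ha'⟩
      · exact huniq a ⟨ha, ha'.1⟩
      · exact ((hnot a ha).2 ha').elim
  exact ⟨⟨_, hpm⟩, hcyc, h, rfl⟩

/-! ### The flip order and the multivariate rank under property (*) -/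

lemma PropertyStar.exists_dimer (hG : G.PropertyStar) (e : E) : ∃ M : G.Dimer, e ∈ M.edges := by
  obtain ⟨M, hM, he⟩ := hG e
  exact ⟨⟨M, hM⟩, he⟩

lemma PropertyStar.nonempty_dimer (hG : G.PropertyStar) : Nonempty G.Dimer := by
  obtain ⟨d, -⟩ := G.faceOf_surjective G.infiniteFace
  exact ⟨(hG.exists_dimer d.1).choose⟩

/-- If `M` is somewhere higher than `M'`, it can be flipped down at a face where it is higher. -/
theorem PropertyStar.exists_downFlip_of_height_pos (hG : G.PropertyStar) {M M' : G.Dimer}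
    {f : G.Face} (hf : 0 < M.height M' f) :
    ∃ (g : G.BoundedFace) (M₂ : G.Dimer), 0 < M.height M' g.1 ∧ DownFlip g M M₂ := by
  have := Fintype.ofFinite G.Dimer
  -- Crossing a black-white edge of `g` missing from `M` lowers none of the heights of `M` relative
  -- to other dimers, and strictly raises the one relative to a dimer containing that edge, which
  -- exists by (*). A maximiser of the sum therefore has no such edge.
  obtain ⟨g, hg, hmax⟩ := Set.exists_max_image {g | 0 < M.height M' g}
    (fun g => ∑ N : G.Dimer, M.height N g) (Set.toFinite _) ⟨f, hf⟩
  have hg' : 0 < M.height M' g := hg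
  have hginf : g ≠ G.infiniteFace := by
    rintro rfl
    simp at hg'
  have hbw : G.blackWhite ⟨g, hginf⟩ ⊆ M.edges := by
    rintro _ ⟨d, rfl, hdg, hdb⟩
    by_contra hdM
    change G.faceOf d = g at hdg
    have hsub : ∀ N : G.Dimer, M.height N g ≤ M.height N (G.faceOf (rev d)) := by
      intro N
      have h1 := M.height_sub N hdb
      have h2 := N.ind_nonneg d.1
      rw [Dimer.ind_of_notMem hdM, hdg] at h1
      omega
    have hlt : ∑ N : G.Dimer, M.height N g < ∑ N : G.Dimer, M.height N (G.faceOf (rev d)) := by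
      obtain ⟨N, hN⟩ := hG.exists_dimer d.1
      refine Finset.sum_lt_sum (fun N _ => hsub N) ⟨N, Finset.mem_univ N, ?_⟩
      have h1 := M.height_sub N hdb
      rw [Dimer.ind_of_notMem hdM, hdg, Dimer.ind_of_mem hN] at h1
      omega
    exact absurd hlt (not_lt.2 (hmax _ (lt_of_lt_of_le hg' (hsub M'))))
  obtain ⟨M₂, hM₂⟩ := exists_downFlip hbw
  exact ⟨⟨g, hginf⟩, M₂, hg', hM₂⟩

lemma height_nonneg_of_le {M M' : G.Dimer} (h : M ≤ M') : 0 ≤ M'.height M := by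
  classical
  change Relation.ReflTransGen _ M' M at h
  induction h with
  | refl => rw [Dimer.height_self]
  | @tail A B _ hAB ih =>
    obtain ⟨f, hf⟩ := hAB
    rw [Dimer.height_add M' A B, hf.height_eq]
    exact add_nonneg ih (Pi.single_nonneg.2 zero_le_one)

lemma DownFlip.le {f : G.BoundedFace} {M' M : G.Dimer} (h : DownFlip f M' M) : M ≤ M' :=
  Relation.ReflTransGen.single ⟨f, h⟩

lemma PropertyStar.exists_downFlip_height_nonneg (hG : G.PropertyStar) {M M₀ : G.Dimer}
    (h : 0 ≤ M.height M₀) (hne : M ≠ M₀) :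
    ∃ (g : G.BoundedFace) (M₂ : G.Dimer), DownFlip g M M₂ ∧ 0 ≤ M₂.height M₀ := by
  classical
  obtain ⟨f, hf⟩ : ∃ f, 0 < M.height M₀ f := by
    by_contra! hle
    exact hne (Dimer.eq_of_height_eq_zero (funext fun f => le_antisymm (hle f) (h f)))
  obtain ⟨g, M₂, hg, hflip⟩ := hG.exists_downFlip_of_height_pos hf
  refine ⟨g, M₂, hflip, fun x => ?_⟩
  have e := congrFun (Dimer.height_add M M₂ M₀) x
  rw [hflip.height_eq, Pi.add_apply] at e
  have hx := h x
  by_cases hxg : x = g.1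
  · subst hxg
    rw [Pi.single_eq_same] at e
    simp only [Pi.zero_apply] at hx ⊢
    omega
  · rw [Pi.single_eq_of_ne hxg] at e
    simp only [Pi.zero_apply] at hx ⊢
    omega

/-- Induction along down-flips towards a fixed lower dimer. -/
lemma PropertyStar.flip_induction (hG : G.PropertyStar) {M₀ : G.Dimer} {P : G.Dimer → Prop}
    (base : P M₀) (step : ∀ f M M₂, DownFlip f M M₂ → 0 ≤ M₂.height M₀ → P M₂ → P M)
    (M : G.Dimer) (h : 0 ≤ M.height M₀) : P M := by
  classical
  have := Fintype.ofFinite G.Face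
  induction hn : (∑ f, M.height M₀ f).toNat using Nat.strong_induction_on generalizing M with
  | _ n ih =>
    by_cases hne : M = M₀
    · rwa [hne]
    obtain ⟨g, M₂, hflip, h₂⟩ := hG.exists_downFlip_height_nonneg h hne
    refine step g M M₂ hflip h₂ (ih _ ?_ M₂ h₂ rfl)
    have e : ∑ f, M.height M₀ f = 1 + ∑ f, M₂.height M₀ f := by
      rw [Dimer.height_add M M₂ M₀, hflip.height_eq]
      simp [Finset.sum_add_distrib]
    have : 0 ≤ ∑ f, M₂.height M₀ f := Finset.sum_nonneg fun f _ => h₂ f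
    omega

lemma PropertyStar.le_iff (hG : G.PropertyStar) {M M' : G.Dimer} :
    M ≤ M' ↔ 0 ≤ M'.height M :=
  ⟨height_nonneg_of_le, hG.flip_induction (P := fun M' => M ≤ M') le_rfl
    (fun _ _ _ hflip _ h => h.trans hflip.le) M'⟩

/-- A minimiser of the total height over a fixed reference `R` works: were it somewhere higher than
another dimer, a flip would lower the total. -/
lemma PropertyStar.exists_isBot (hG : G.PropertyStar) : ∃ M₀ : G.Dimer, IsBot M₀ := by
  classical
  have := Fintype.ofFinite G.Face
  have := hG.nonempty_dimer
  let R : G.Dimer := Classical.arbitrary _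
  obtain ⟨M₀, hM₀⟩ := Finite.exists_min fun M : G.Dimer => ∑ f, M.height R f
  refine ⟨M₀, fun M => hG.le_iff.2 fun f => ?_⟩
  by_contra hneg
  have hpos : 0 < M₀.height M f := by
    rw [Dimer.height_comm]
    simpa using hneg
  obtain ⟨g, M₂, -, hflip⟩ := hG.exists_downFlip_of_height_pos hpos
  have e : ∑ f, M₀.height R f = 1 + ∑ f, M₂.height R f := by
    rw [Dimer.height_add M₀ M₂ R, hflip.height_eq]
    simp [Finset.sum_add_distrib]
  have := hM₀ M₂
  omega

/-- An intermediate dimer would split the height difference, a single unit at `f`, into two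
nonnegative integral parts, one of which is zero. -/
lemma DownFlip.covBy {f : G.BoundedFace} {M' M : G.Dimer}
    (h : DownFlip f M' M) : M ⋖ M' := by
  classical
  have e := h.height_eq
  refine ⟨lt_of_le_not_ge h.le fun hle => ?_, fun c h1 h2 => ?_⟩
  · have h1 := height_nonneg_of_le hle f.1
    rw [Dimer.height_comm, e] at h1
    simp at h1
  · have h3 := height_nonneg_of_le h1.le
    have h4 := height_nonneg_of_le h2.le
    rw [Dimer.height_add M' c M] at e
    have hzero : ∀ x, x ≠ f.1 → M'.height c x = 0 ∧ c.height M x = 0 := by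
      intro x hx
      have := congrFun e x
      rw [Pi.single_eq_of_ne hx, Pi.add_apply] at this
      have h5 := h3 x
      have h6 := h4 x
      simp only [Pi.zero_apply] at h5 h6
      omega
    have hf := congrFun e f.1
    rw [Pi.single_eq_same, Pi.add_apply] at hf
    have h5 := h3 f.1
    have h6 := h4 f.1
    simp only [Pi.zero_apply] at h5 h6
    rcases (by omega : M'.height c f.1 = 0 ∨ c.height M f.1 = 0) with h7 | h7
    · have : M' = c := Dimer.eq_of_height_eq_zero (funext fun x => by
        by_cases hx : x = f.1
        · rw [hx, h7]; rfl
        · exact (hzero x hx).1)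
      exact lt_irrefl _ (this ▸ h2)
    · have : c = M := Dimer.eq_of_height_eq_zero (funext fun x => by
        by_cases hx : x = f.1
        · rw [hx, h7]; rfl
        · exact (hzero x hx).2)
      exact lt_irrefl _ (this ▸ h1)

lemma PropertyStar.exists_saturatedChain (hG : G.PropertyStar) {M₀ M : G.Dimer}
    (h : 0 ≤ M.height M₀) : ∃ w, SaturatedChain M₀ M w :=
  hG.flip_induction (P := fun M => ∃ w, SaturatedChain M₀ M w) ⟨0, .nil⟩
    (fun f _ _ hflip _ ⟨_, hw⟩ => ⟨_, hw.snoc f hflip.covBy hflip⟩) M h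

lemma SaturatedChain.eq_height {M₀ M : G.Dimer} {w : G.BoundedFace →₀ ℕ}
    (h : SaturatedChain M₀ M w) (f : G.BoundedFace) : (w f : ℤ) = M.height M₀ f.1 := by
  classical
  induction h with
  | nil => simp [Dimer.height_self]
  | @snoc M M' w g _ _ hflip ih =>
    rw [Dimer.height_add M' M M₀, hflip.height_eq, Pi.add_apply, ← ih]
    by_cases hfg : f = g
    · subst hfg
      simp [add_comm]
    · have : f.1 ≠ g.1 := fun h => hfg (Subtype.ext h)
      simp [Pi.single_eq_of_ne this, Finsupp.single_eq_of_ne hfg]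

/-- The multivariate rank is the height above the minimal dimer. -/
theorem PropertyStar.multivariateRank_eq_height (hG : G.PropertyStar) {M₀ : G.Dimer}
    (h₀ : IsBot M₀) (M : G.Dimer) (f : G.BoundedFace) :
    (multivariateRank M f : ℤ) = M.height M₀ f.1 := by
  have hex : ∃ w : G.BoundedFace →₀ ℕ, ∃ M₀ : G.Dimer, IsBot M₀ ∧ SaturatedChain M₀ M w := by
    obtain ⟨w, hw⟩ := hG.exists_saturatedChain (height_nonneg_of_le (h₀ M))
    exact ⟨w, M₀, h₀, hw⟩
  obtain ⟨M₁, h₁, hc⟩ := hex.choose_spec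
  -- The order is only given as a preorder; two minimal dimers coincide because their relative
  -- height is both nonnegative and nonpositive.
  have : M₀ = M₁ := by
    refine Dimer.eq_of_height_eq_zero (le_antisymm ?_ (height_nonneg_of_le (h₁ M₀)))
    rw [Dimer.height_comm]
    exact neg_nonpos.2 (height_nonneg_of_le (h₀ M₁))
  subst this
  rw [multivariateRank, dif_pos hex]
  exact hc.eq_height f

/-- The exponents of the dimer face polynomial are the multivariate ranks of the dimers. -/
lemma support_dimerFacePolynomial :
    (G.dimerFacePolynomial.support : Set (G.BoundedFace →₀ ℕ)) =
      Set.range (multivariateRank : G.Dimer → _) := by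
  classical
  have := Fintype.ofFinite G.Dimer
  ext w
  rw [Finset.mem_coe, MvPolynomial.mem_support_iff, dimerFacePolynomial,
    finsum_eq_sum_of_fintype, MvPolynomial.coeff_sum]
  simp only [MvPolynomial.coeff_monomial, Finset.sum_boole, Set.mem_range]
  -- The coefficient counts the dimers with exponent `w`, so nothing cancels.
  rw [Nat.cast_ne_zero, Finset.card_ne_zero]
  simp [Finset.Nonempty]

end BipartitePlaneGraph

namespace BipartitePlaneGraph

open EmbeddedGraph

variable {V E : Type*} {G : BipartitePlaneGraph V E}

/-! ### Regular edge weights decompose into dimers -/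

section Regular

open Classical in
/-- An integral weight on the edges with the same sum `n` at each vertex. -/
def IsRegularWeight [Fintype E] (G : BipartitePlaneGraph V E) (m : E → ℤ) (n : ℤ) : Prop :=
  ∀ v : V, ∑ d : E × Bool with G.tail d = v, m d.1 = n

variable [Fintype E]

lemma Dimer.isRegularWeight_ind (M : G.Dimer) : G.IsRegularWeight M.ind 1 :=
  fun v => by classical exact M.sum_ind_tail v

lemma IsRegularWeight.sub {m m' : E → ℤ} {n n' : ℤ} (h : G.IsRegularWeight m n)
    (h' : G.IsRegularWeight m' n') : G.IsRegularWeight (m - m') (n - n') := by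
  intro v
  rw [← h v, ← h' v, ← Finset.sum_sub_distrib]
  rfl

lemma isRegularWeight_sum_ind (T : Finset G.Dimer) :
    G.IsRegularWeight (∑ N ∈ T, N.ind) T.card := by
  classical
  intro v
  simp only [Finset.sum_apply]
  rw [Finset.sum_comm, Finset.sum_congr rfl fun N _ => N.isRegularWeight_ind v]
  simp

lemma IsRegularWeight.sum_mul_tail [Fintype V] {m : E → ℤ} {n : ℤ} (h : G.IsRegularWeight m n)
    (q : V → ℤ) : ∑ d : E × Bool, m d.1 * q (G.tail d) = n * ∑ v, q v := by
  classical
  rw [← Finset.sum_fiberwise Finset.univ G.tail, Finset.mul_sum]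
  refine Finset.sum_congr rfl fun v _ => ?_
  rw [← h v, Finset.sum_mul]
  refine Finset.sum_congr (by congr) fun d hd => ?_
  rw [(Finset.mem_filter.1 hd).2]

lemma IsRegularWeight.sum_mul_head [Fintype V] {m : E → ℤ} {n : ℤ} (h : G.IsRegularWeight m n)
    (q : V → ℤ) : ∑ d : E × Bool, m d.1 * q (G.head d) = n * ∑ v, q v := by
  rw [← h.sum_mul_tail, ← Equiv.sum_comp rev]
  simp

/-- A regular weight of positive degree has a dimer in its support. -/
theorem IsRegularWeight.exists_dimer {m : E → ℤ} {n : ℤ} (h : G.IsRegularWeight m n)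
    (hm : 0 ≤ m) (hn : 0 < n) : ∃ N : G.Dimer, ∀ e ∈ N.edges, 0 < m e := by
  classical
  have := G.finite_vertices
  have := Fintype.ofFinite V
  let t : {v // v ∈ G.black} → Finset V := fun b =>
    {w | ∃ d : E × Bool, G.tail d = b ∧ G.head d = w ∧ 0 < m d.1}
  -- Hall's condition by double counting: weight `n * #s` leaves `s`, all of it into `s.biUnion t`,
  -- which receives `n` per vertex.
  have hall : ∀ s : Finset {v // v ∈ G.black}, s.card ≤ (s.biUnion t).card := by
    intro s
    have e1 := h.sum_mul_tail fun v => if v ∈ s.map (Function.Embedding.subtype _) then 1 else 0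
    have e2 := h.sum_mul_head fun v => if v ∈ s.biUnion t then 1 else 0
    rw [Finset.sum_boole, Finset.filter_univ_mem, Finset.card_map] at e1
    rw [Finset.sum_boole, Finset.filter_univ_mem] at e2
    have : n * (s.card : ℤ) ≤ n * ((s.biUnion t).card : ℤ) := by
      rw [← e1, ← e2]
      refine Finset.sum_le_sum fun d _ => ?_
      rcases (hm d.1).eq_or_lt with h0 | h0
      · simp [← h0]
      · refine mul_le_mul_of_nonneg_left ?_ h0.le
        by_cases hd : G.tail d ∈ s.map (Function.Embedding.subtype _)
        · have hd' : G.head d ∈ s.biUnion t := by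
            obtain ⟨b, hb, hbd⟩ := Finset.mem_map.1 hd
            exact Finset.mem_biUnion.2 ⟨b, hb,
              Finset.mem_filter.2 ⟨Finset.mem_univ _, d, hbd.symm, rfl, h0⟩⟩
          rw [if_pos hd, if_pos hd']
        · rw [if_neg hd]
          split_ifs <;> simp
    exact_mod_cast le_of_mul_le_mul_left this hn
  obtain ⟨φ, hφ, hφt⟩ := (Finset.all_card_le_biUnion_card_iff_exists_injective t).1 hall
  have hdart : ∀ b : {v // v ∈ G.black}, ∃ d : E × Bool,
      G.tail d = b ∧ G.head d = φ b ∧ 0 < m d.1 := fun b => (Finset.mem_filter.1 (hφt b)).2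
  choose δ hδt hδh hδm using hdart
  -- Counting the total weight from both colours gives equally many black and white vertices, so the
  -- injective matching `φ` also covers all white ones.
  have hwhite : ∀ w, w ∉ G.black → ∃ b, φ b = w := by
    have e1 := h.sum_mul_tail fun v => if v ∈ G.black then 1 else 0
    have e2 := h.sum_mul_head fun v => if v ∉ G.black then 1 else 0
    have e3 : ∀ d : E × Bool, (if G.head d ∉ G.black then 1 else 0 : ℤ) =
        if G.tail d ∈ G.black then 1 else 0 := fun d => by simp only [G.proper d]
    simp only [e3, e1, Finset.sum_boole] at e2
    have e4 := mul_left_cancel₀ hn.ne' e2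
    have hsub : Finset.univ.image φ ⊆ ({v | v ∉ G.black} : Finset V) := by
      intro w hw
      obtain ⟨b, -, rfl⟩ := Finset.mem_image.1 hw
      rw [Finset.mem_filter, ← hδh b, ← G.proper, hδt]
      exact ⟨Finset.mem_univ _, b.2⟩
    have heq := Finset.eq_of_subset_of_card_le hsub (by
      rw [Finset.card_image_of_injective _ hφ, Finset.card_univ, Fintype.card_subtype]
      exact_mod_cast e4.ge)
    intro w hw
    have : w ∈ Finset.univ.image φ := heq ▸ Finset.mem_filter.2 ⟨Finset.mem_univ _, hw⟩
    simpa using this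
  have hδb : ∀ b, G.tail (δ b) ∈ G.black := fun b => hδt b ▸ b.2
  have hpm : IsPerfectMatching G.toGraph (Set.range fun b => (δ b).1) := by
    rw [isPerfectMatching_iff]
    intro v
    by_cases hv : v ∈ G.black
    · refine ⟨δ ⟨v, hv⟩, ⟨hδt _, ⟨_, rfl⟩⟩, ?_⟩
      rintro d ⟨rfl, b, hb⟩
      have : δ b = d := dart_eq_of_fst_eq hb (iff_of_true (hδb b) hv)
      subst this
      congr 1
      exact Subtype.ext (hδt b).symm
    · obtain ⟨b, rfl⟩ := hwhite v hv
      refine ⟨rev (δ b), ⟨hδh b, ⟨b, rfl⟩⟩, ?_⟩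
      rintro d ⟨hd, b', hb'⟩
      have hrev : δ b' = rev d := dart_eq_of_fst_eq hb' (by
        rw [tail_rev_mem_black_iff, hd]
        simp [hδb, hv])
      have hbb : φ b' = φ b := by rw [← hδh, hrev, head_rev, hd]
      rw [← hφ hbb, hrev, rev_rev]
  refine ⟨⟨_, hpm⟩, ?_⟩
  rintro _ ⟨b, rfl⟩
  exact hδm b

/-- A linear function that is bounded by `α` on dimers is bounded by `n * α` on regular weights of
degree `n`. -/
theorem IsRegularWeight.sum_le {c : E → ℝ} {α : ℝ}
    (hc : ∀ N : G.Dimer, ∑ e, c e * N.ind e ≤ α) (n : ℕ) :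
    ∀ m : E → ℤ, 0 ≤ m → G.IsRegularWeight m n → ∑ e, c e * m e ≤ n * α := by
  classical
  induction n with
  | zero =>
    intro m hm h
    have hzero : ∀ e, m e = 0 := by
      intro e
      have := h (G.tail (e, true))
      rw [Nat.cast_zero, Finset.sum_eq_zero_iff_of_nonneg fun d _ => hm d.1] at this
      exact this (e, true) (by simp)
    simp [hzero]
  | succ n ih =>
    intro m hm h
    -- Removing a dimer from the support keeps the weight nonnegative and lowers its degree by one.
    obtain ⟨N, hN⟩ := h.exists_dimer hm (by positivity)
    have h' := ih (m - N.ind) (fun e => by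
      by_cases he : e ∈ N.edges
      · have := hN e he
        simp only [Pi.sub_apply, Pi.zero_apply, Dimer.ind_of_mem he]
        omega
      · simpa [Dimer.ind_of_notMem he] using hm e) (by
      simpa using h.sub N.isRegularWeight_ind)
    have h2 := hc N
    have h3 : ∑ e, c e * m e = ∑ e, c e * (m - N.ind) e + ∑ e, c e * N.ind e := by
      rw [← Finset.sum_add_distrib]
      refine Finset.sum_congr rfl fun e _ => ?_
      push_cast [Pi.sub_apply]
      ring
    push_cast
    linarith

end Regular

/-- If `M` is covered by the dimers in `T`, then the sum of `T` minus `M` is bounded like a sum of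
`#T - 1` dimers by any linear function. -/
lemma sum_sub_le [Fintype E] (T : Finset G.Dimer) (M : G.Dimer)
    (hM : M.edges ⊆ ⋃ N ∈ T, N.edges) {c : E → ℝ} {α : ℝ}
    (hc : ∀ N : G.Dimer, ∑ e, c e * N.ind e ≤ α) :
    ∑ N ∈ T, ∑ e, c e * N.ind e - ∑ e, c e * M.ind e ≤ (T.card - 1) * α := by
  have hT : 1 ≤ T.card := by
    obtain ⟨e, he⟩ := M.edges_nonempty
    obtain ⟨N, hN, -⟩ := Set.mem_iUnion₂.1 (hM he)
    exact Finset.card_pos.2 ⟨N, hN⟩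
  have := IsRegularWeight.sum_le hc (T.card - 1) (∑ N ∈ T, N.ind - M.ind) (fun e => by
    rw [Pi.zero_apply, Pi.sub_apply, Finset.sum_apply, sub_nonneg]
    by_cases he : e ∈ M.edges
    · obtain ⟨N, hN, heN⟩ := Set.mem_iUnion₂.1 (hM he)
      rw [Dimer.ind_of_mem he, ← Dimer.ind_of_mem heN]
      exact Finset.single_le_sum (f := fun N : G.Dimer => N.ind e)
        (fun N _ => N.ind_nonneg e) hN
    · rw [Dimer.ind_of_notMem he]
      exact Finset.sum_nonneg fun N _ => N.ind_nonneg e) (by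
    rw [Nat.cast_sub hT]
    exact_mod_cast (isRegularWeight_sum_ind T).sub M.isRegularWeight_ind)
  rw [Nat.cast_sub hT, Nat.cast_one] at this
  refine le_trans (le_of_eq ?_) this
  rw [Finset.sum_comm, ← Finset.sum_sub_distrib]
  refine Finset.sum_congr rfl fun e _ => ?_
  rw [← Finset.mul_sum, ← mul_sub, Pi.sub_apply, Finset.sum_apply]
  push_cast
  rfl

end BipartitePlaneGraph

/-! ### Faces of a polytope of indicator vectors with the exchange property -/

/-- A finite family of points, indexed by subsets `A i` of a finite set `E`, which an injective
affine map `x ↦ L x + a` sends to the indicator functions of these subsets, and which satisfies an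
exchange property. -/
structure IndicatorFamily {I E ι : Type*} [Fintype E] (A : ι → Set E) (v : ι → I → ℝ)
    (L : (I → ℝ) →ₗ[ℝ] E → ℝ) (a : E → ℝ) : Prop where
  nonempty : ∀ i, (A i).Nonempty
  injective : Function.Injective L
  map_add : ∀ i, L (v i) + a = (A i).indicator 1
  exchange : ∀ (T : Finset ι) (i : ι), A i ⊆ ⋃ j ∈ T, A j → ∀ (c : E → ℝ) (α : ℝ),
    (∀ j, ∑ e, c e * (A j).indicator 1 e ≤ α) →
    ∑ j ∈ T, ∑ e, c e * (A j).indicator 1 e - ∑ e, c e * (A i).indicator 1 e ≤ (T.card - 1) * α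

namespace IndicatorFamily

variable {I E ι : Type*} [Fintype E] {A : ι → Set E} {v : ι → I → ℝ}
  {L : (I → ℝ) →ₗ[ℝ] E → ℝ} {a : E → ℝ}

/-- The union of the sets whose points lie in `F`. -/
def support (A : ι → Set E) (v : ι → I → ℝ) (F : Set (I → ℝ)) : Set E :=
  ⋃ i ∈ {i | v i ∈ F}, A i

/-- The points of the polytope whose images vanish outside of `S`. -/
def supportedOn (v : ι → I → ℝ) (L : (I → ℝ) →ₗ[ℝ] E → ℝ) (a : E → ℝ) (S : Set E) :
    Set (I → ℝ) :=
  {x ∈ convexHull ℝ (Set.range v) | ∀ e ∉ S, L x e + a e = 0}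

omit [Fintype E] in
lemma indicator_one_nonneg (S : Set E) (e : E) : 0 ≤ S.indicator (1 : E → ℝ) e :=
  Set.indicator_nonneg (fun _ _ => zero_le_one) e

omit [Fintype E] in
lemma supportedOn_mono {S S' : Set E} (h : S ⊆ S') :
    supportedOn v L a S ⊆ supportedOn v L a S' :=
  fun _ hx => ⟨hx.1, fun e he => hx.2 e fun h' => he (h h')⟩

variable (hA : IndicatorFamily A v L a)
include hA

lemma map_add_apply (i : ι) (e : E) : L (v i) e + a e = (A i).indicator 1 e :=
  congrFun (hA.map_add i) e

lemma map_add_sum {κ : Type*} [Fintype κ] {w : κ → ℝ} (hw : ∑ k, w k = 1) (j : κ → ι) (e : E) :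
    L (∑ k, w k • v (j k)) e + a e = ∑ k, w k * (A (j k)).indicator 1 e := by
  have : a e = ∑ k, w k * a e := by rw [← Finset.sum_mul, hw, one_mul]
  rw [this, map_sum, Finset.sum_apply, ← Finset.sum_add_distrib]
  refine Finset.sum_congr rfl fun k _ => ?_
  rw [← hA.map_add_apply, map_smul, Pi.smul_apply, smul_eq_mul, mul_add]

omit hA in
lemma exists_weights {x : I → ℝ} (hx : x ∈ convexHull ℝ (Set.range v)) :
    ∃ (κ : Type) (_ : Fintype κ) (w : κ → ℝ) (j : κ → ι), (∀ k, 0 ≤ w k) ∧ ∑ k, w k = 1 ∧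
      ∑ k, w k • v (j k) = x := by
  rw [mem_convexHull_iff_exists_fintype] at hx
  obtain ⟨κ, hκ, w, z, hw, hw1, hz, hx⟩ := hx
  choose j hj using hz
  exact ⟨κ, hκ, w, j, hw, hw1, by simpa only [hj] using hx⟩

lemma nonneg {x : I → ℝ} (hx : x ∈ convexHull ℝ (Set.range v)) (e : E) : 0 ≤ L x e + a e := by
  obtain ⟨κ, _, w, j, hw, hw1, rfl⟩ := exists_weights hx
  rw [hA.map_add_sum hw1]
  exact Finset.sum_nonneg fun k _ =>
    mul_nonneg (hw k) (indicator_one_nonneg _ _)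

lemma mem_supportedOn_iff {i : ι} {S : Set E} : v i ∈ supportedOn v L a S ↔ A i ⊆ S := by
  constructor
  · intro h e he
    by_contra heS
    have := h.2 e heS
    rw [hA.map_add_apply, Set.indicator_of_mem he] at this
    exact one_ne_zero this
  · intro h
    refine ⟨subset_convexHull ℝ _ ⟨i, rfl⟩, fun e he => ?_⟩
    rw [hA.map_add_apply, Set.indicator_of_notMem fun h' => he (h h')]

/-- The sum of the coordinates outside `S` is nonnegative on the polytope and vanishes exactly on
this set; if the set is nonempty, the negated sum exposes it. -/
lemma isExposed_supportedOn [Finite I] (S : Set E) :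
    IsExposed ℝ (convexHull ℝ (Set.range v)) (supportedOn v L a S) := by
  classical
  rintro ⟨x₀, hx₀⟩
  let l : (I → ℝ) →ₗ[ℝ] ℝ := -∑ e with e ∉ S, (LinearMap.proj e).comp L
  have hl : ∀ x, l x = ∑ e with e ∉ S, a e - ∑ e with e ∉ S, (L x e + a e) := by
    intro x
    simp [l, Finset.sum_add_distrib]
  have hsupp : ∀ x ∈ supportedOn v L a S, ∑ e with e ∉ S, (L x e + a e) = 0 := fun x hx =>
    Finset.sum_eq_zero fun e he => hx.2 e (Finset.mem_filter.1 he).2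
  refine ⟨LinearMap.toContinuousLinearMap l, ?_⟩
  simp only [LinearMap.coe_toContinuousLinearMap']
  ext x
  constructor
  · intro hx
    refine ⟨hx.1, fun y hy => ?_⟩
    rw [hl, hl, hsupp x hx]
    have := Finset.sum_nonneg fun e (_ : e ∈ Finset.univ.filter (· ∉ S)) => hA.nonneg hy e
    linarith
  · rintro ⟨hx, hmax⟩
    refine ⟨hx, fun e he => ?_⟩
    have h1 := hmax x₀ hx₀.1
    rw [hl, hl, hsupp x₀ hx₀] at h1
    have h2 := Finset.single_le_sum (s := Finset.univ.filter (· ∉ S))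
      (f := fun e => L x e + a e) (fun e _ => hA.nonneg hx e)
      (Finset.mem_filter.2 ⟨Finset.mem_univ e, he⟩)
    have h3 := hA.nonneg hx e
    linarith

/-- This is the step that uses `exchange`: it forces the exposing functional to be maximal at `v i`
too. -/
lemma mem_of_subset_support [Finite ι] {F : Set (I → ℝ)}
    (hF : IsExposed ℝ (convexHull ℝ (Set.range v)) F) {i : ι} (hi : A i ⊆ support A v F) :
    v i ∈ F := by
  classical
  have := Fintype.ofFinite ι
  -- Because `A i` is nonempty, so is `F`, and an exposing functional exists.
  obtain ⟨e, he⟩ := hA.nonempty i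
  obtain ⟨i₀, hi₀, -⟩ := Set.mem_iUnion₂.1 (hi he)
  obtain ⟨l, hl⟩ := hF ⟨v i₀, hi₀⟩
  -- A left inverse of `L` rewrites `l`, up to the constant `l (g a)`, as a weight on `E`.
  obtain ⟨g, hg⟩ := L.exists_leftInverse_of_injective (LinearMap.ker_eq_bot.2 hA.injective)
  have hlv : ∀ j, ∑ e, l (g (Pi.single e 1)) * (A j).indicator 1 e = l (v j) + l (g a) := by
    intro j
    have h1 : v j = g (L (v j)) := (LinearMap.congr_fun hg (v j)).symm
    have h2 : (A j).indicator (1 : E → ℝ) =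
        ∑ e, (A j).indicator (1 : E → ℝ) e • Pi.single e (1 : ℝ) :=
      (pi_eq_sum_univ' _).trans (Finset.sum_congr rfl fun e _ => by
        congr 1)
    conv_rhs => rw [h1, ← _root_.map_add, ← _root_.map_add, hA.map_add j, h2, map_sum, map_sum]
    refine Finset.sum_congr rfl fun e _ => ?_
    rw [map_smul, map_smul, smul_eq_mul, mul_comm]
  have hP : ∀ j, v j ∈ convexHull ℝ (Set.range v) := fun j => subset_convexHull ℝ _ ⟨j, rfl⟩
  have hmax : ∀ j ∈ ({j | v j ∈ F} : Finset ι), l (v j) = l (v i₀) := by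
    intro j hj
    have hj := (Finset.mem_filter.1 hj).2
    have hi₀' : v i₀ ∈ F := hi₀
    rw [hl] at hj hi₀'
    exact le_antisymm (hi₀'.2 _ (hP j)) (hj.2 _ (hP i₀))
  have hex := hA.exchange {j | v j ∈ F} i (by simpa [support] using hi)
    (fun e => l (g (Pi.single e 1))) (l (v i₀) + l (g a)) (fun j => by
      have hi₀' : v i₀ ∈ F := hi₀
      rw [hl] at hi₀'
      rw [hlv]
      exact add_le_add_left (hi₀'.2 _ (hP j)) _)
  simp only [hlv] at hex
  rw [Finset.sum_congr rfl fun j hj => by rw [hmax j hj], Finset.sum_const, nsmul_eq_mul] at hex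
  have hle : l (v i₀) ≤ l (v i) := by linarith
  have hi₀' : v i₀ ∈ F := hi₀
  rw [hl] at hi₀' ⊢
  exact ⟨hP i, fun y hy => (hi₀'.2 y hy).trans hle⟩

lemma supportedOn_support [Finite ι] {F : Set (I → ℝ)}
    (hF : IsExposed ℝ (convexHull ℝ (Set.range v)) F) :
    supportedOn v L a (support A v F) = F := by
  classical
  ext x
  constructor
  · rintro ⟨hx, hx0⟩
    obtain ⟨κ, _, w, j, hw, hw1, rfl⟩ := exists_weights hx
    -- Coordinates are nonnegative, so a point used with nonzero weight vanishes wherever `x` does;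
    -- its set thus lies in the support of `F`.
    have hmem : ∀ k, w k ≠ 0 → v (j k) ∈ F := by
      intro k hk
      refine hA.mem_of_subset_support hF fun e he => ?_
      by_contra heS
      have h0 := hx0 e heS
      rw [hA.map_add_sum hw1, Finset.sum_eq_zero_iff_of_nonneg fun k _ =>
        mul_nonneg (hw k) (indicator_one_nonneg _ _)] at h0
      have := h0 k (Finset.mem_univ k)
      rw [Set.indicator_of_mem he] at this
      simp [hk] at this
    rw [← Finset.sum_filter_of_ne (p := fun k => w k ≠ 0) fun k _ hk h0 => hk (by simp [h0])]
    refine (hF.convex (convex_convexHull ℝ _)).sum_mem (fun k _ => hw k) ?_ fun k hk =>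
      hmem k (Finset.mem_filter.1 hk).2
    rw [Finset.sum_filter_ne_zero, hw1]
  · intro hx
    obtain ⟨l, hl⟩ := hF ⟨x, hx⟩
    have hxP := hF.subset hx
    obtain ⟨κ, _, w, j, hw, hw1, rfl⟩ := exists_weights hxP
    set x := ∑ k, w k • v (j k) with hxdef
    rw [hl] at hx
    have hle : ∀ k, l (v (j k)) ≤ l x := fun k => hx.2 _ (subset_convexHull ℝ _ ⟨_, rfl⟩)
    -- A maximiser of `l` averages values of `l` none of which exceeds its own, so every point with
    -- nonzero weight is itself a maximiser.
    have hsum : ∑ k, w k * (l x - l (v (j k))) = 0 := by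
      have : l x = ∑ k, w k * l (v (j k)) := by simp [hxdef, map_sum]
      simp only [mul_sub, Finset.sum_sub_distrib]
      rw [← Finset.sum_mul, hw1, one_mul, ← this, sub_self]
    rw [Finset.sum_eq_zero_iff_of_nonneg fun k _ =>
      mul_nonneg (hw k) (sub_nonneg.2 (hle k))] at hsum
    refine ⟨hxP, fun e he => ?_⟩
    rw [hA.map_add_sum hw1]
    refine Finset.sum_eq_zero fun k _ => ?_
    rcases mul_eq_zero.1 (hsum k (Finset.mem_univ k)) with h0 | h0
    · rw [h0, zero_mul]
    · have hk : v (j k) ∈ F := by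
        rw [hl]
        exact ⟨subset_convexHull ℝ _ ⟨_, rfl⟩, fun y hy => (hx.2 y hy).trans (sub_eq_zero.1 h0).le⟩
      rw [Set.indicator_of_notMem fun h' => he (Set.mem_biUnion (show j k ∈ {i | v i ∈ F} from hk)
        h'), mul_zero]

lemma support_supportedOn {S : Set E} (hS : ∃ T : Set ι, S = ⋃ i ∈ T, A i) :
    support A v (supportedOn v L a S) = S := by
  refine subset_antisymm (Set.iUnion₂_subset fun i hi => hA.mem_supportedOn_iff.1 hi) ?_
  obtain ⟨T, rfl⟩ := hS
  exact Set.iUnion₂_subset fun i hi => Set.subset_biUnion_of_mem (u := A)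
    (show i ∈ {i | v i ∈ _} from hA.mem_supportedOn_iff.2 (Set.subset_biUnion_of_mem hi))

/-- The face lattice of the polytope is the lattice of unions of the given sets. -/
def faceLatticeIso [Finite I] [Finite ι] :
    FaceLattice (convexHull ℝ (Set.range v)) ≃o {S : Set E // ∃ T : Set ι, S = ⋃ i ∈ T, A i} where
  toFun F := ⟨support A v F.1, {i | v i ∈ F.1}, rfl⟩
  invFun S := ⟨supportedOn v L a S.1, hA.isExposed_supportedOn S.1⟩
  left_inv F := Subtype.ext (hA.supportedOn_support F.2)
  right_inv S := Subtype.ext (hA.support_supportedOn S.2)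
  map_rel_iff' := by
    intro F F'
    constructor
    · intro h
      have := supportedOn_mono (v := v) (L := L) (a := a) h
      change F.1 ⊆ F'.1
      simpa only [Equiv.coe_fn_mk, hA.supportedOn_support F.2, hA.supportedOn_support F'.2]
        using this
    · exact fun h => Set.biUnion_subset_biUnion_left fun i hi => h hi

end IndicatorFamily

/-! ### Elementary subgraphs as unions of dimers -/

namespace BipartitePlaneGraph

open EmbeddedGraph

variable {V E : Type*} {G : BipartitePlaneGraph V E}

/-- A spanning subgraph has the same vertices and the same incidences along its edges, so only
containment in `E(H)` matters. -/
lemma isPerfectMatching_spanningSubgraph_iff {H : Graph V E} (hH : H ≤s G.toGraph) {M : Set E} :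
    IsPerfectMatching H M ↔ IsPerfectMatching G.toGraph M ∧ M ⊆ E(H) := by
  have hinc : ∀ {e v}, e ∈ E(H) → (H.Inc e v ↔ G.toGraph.Inc e v) := fun he =>
    hH.le.inc_congr he
  have hV : V(H) = V(G.toGraph) := hH.vertexSet_eq
  constructor
  · rintro ⟨hM, h⟩
    refine ⟨⟨hM.trans hH.le.edgeSet_mono, fun v hv => ?_⟩, hM⟩
    refine (existsUnique_congr fun e => and_congr_right fun he => ?_).1 (h v (hV ▸ hv))
    exact hinc (hM he)
  · rintro ⟨⟨-, h⟩, hM⟩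
    refine ⟨hM, fun v hv => ?_⟩
    refine (existsUnique_congr fun e => and_congr_right fun he => ?_).1 (h v (hV ▸ hv))
    exact (hinc (hM he)).symm

/-- The elementary subgraphs are the spanning subgraphs whose edge sets are unions of dimers. -/
theorem isElementary_iff {H : Graph V E} : IsElementary H G.toGraph ↔
    H ≤s G.toGraph ∧ ∃ S : Set G.Dimer, E(H) = ⋃ M ∈ S, M.edges := by
  constructor
  · rintro ⟨hH, h⟩
    refine ⟨hH, {M | M.edges ⊆ E(H)}, subset_antisymm (fun e he => ?_)
      (Set.iUnion₂_subset fun M hM => hM)⟩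
    obtain ⟨M, hM, heM⟩ := h e he
    rw [isPerfectMatching_spanningSubgraph_iff hH] at hM
    exact Set.mem_biUnion (show (⟨M, hM.1⟩ : G.Dimer) ∈ {M : G.Dimer | M.edges ⊆ E(H)} from hM.2)
      heM
  · rintro ⟨hH, S, hS⟩
    refine ⟨hH, fun e he => ?_⟩
    rw [hS] at he
    obtain ⟨M, hM, heM⟩ := Set.mem_iUnion₂.1 he
    refine ⟨M.edges, (isPerfectMatching_spanningSubgraph_iff hH).2 ⟨M.isPerfectMatching, ?_⟩, heM⟩
    rw [hS]
    exact Set.subset_biUnion_of_mem (u := Dimer.edges) hM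

variable (G) in
/-- Elementary subgraphs correspond to unions of dimers. -/
def unionIso : {S : Set E // ∃ T : Set G.Dimer, S = ⋃ M ∈ T, M.edges} ≃o
    ElementarySubgraph G.toGraph where
  toFun S := ⟨G.toGraph.restrict S.1, isElementary_iff.2
    ⟨⟨Graph.restrict_le, rfl⟩, by
      obtain ⟨S, T, hT⟩ := S
      exact ⟨T, by simp [hT, toGraph]⟩⟩⟩
  invFun H := ⟨E(H.1), (isElementary_iff.1 H.2).2⟩
  left_inv S := Subtype.ext (by simp [toGraph])
  right_inv H := Subtype.ext (by
    refine Graph.IsSpanningSubgraph.ext_of_edgeSet ?_ ?_ (G := H.1)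
    · simp [toGraph]
    · have hH := H.2.isSpanningSubgraph
      refine ⟨⟨?_, fun e x y h => ?_⟩, ?_⟩
      · rw [hH.vertexSet_eq]; rfl
      · rw [Graph.restrict_isLink] at h
        exact (hH.le.isLink_iff h.1).2 h.2
      · rw [hH.vertexSet_eq]; rfl)
  map_rel_iff' := by
    intro S S'
    constructor
    · intro h
      have hE : ∀ S : Set E, E(G.toGraph.restrict S) = S := fun S => Set.univ_inter S
      have := Graph.IsSubgraph.edgeSet_mono (H := G.toGraph.restrict S.1)
        (G := G.toGraph.restrict S'.1) h
      rwa [hE, hE] at this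
    · exact fun h => Graph.restrict_mono_right _ h

/-! ### The Newton polytope in edge coordinates -/

open Classical in
/-- The extension of a function on the bounded faces by zero at the infinite face. -/
def extendByZero (w : G.BoundedFace → ℝ) (f : G.Face) : ℝ :=
  if h : f = G.infiniteFace then 0 else w ⟨f, h⟩

@[simp] lemma extendByZero_infiniteFace (w : G.BoundedFace → ℝ) :
    extendByZero w G.infiniteFace = 0 := dif_pos rfl

@[simp] lemma extendByZero_boundedFace (w : G.BoundedFace → ℝ) (f : G.BoundedFace) :
    extendByZero w f.1 = w f := dif_neg f.2

lemma extendByZero_eq {w : G.BoundedFace → ℝ} {h : G.Face → ℝ} (h0 : h G.infiniteFace = 0)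
    (hw : ∀ f : G.BoundedFace, w f = h f.1) : extendByZero w = h := by
  funext f
  by_cases hf : f = G.infiniteFace
  · rw [hf, extendByZero_infiniteFace, h0]
  · exact (extendByZero_boundedFace w ⟨f, hf⟩).trans (hw _)

lemma extendByZero_add (w w' : G.BoundedFace → ℝ) :
    extendByZero (w + w') = extendByZero w + extendByZero w' :=
  extendByZero_eq (by simp) (by simp)

lemma extendByZero_smul (c : ℝ) (w : G.BoundedFace → ℝ) :
    extendByZero (c • w) = c • extendByZero w :=
  extendByZero_eq (by simp) (by simp)

variable (G) in
/-- The linear map that sends a function on the bounded faces to its jumps across the edges, from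
the face to the left to the face to the right of the edge directed from black to white. -/
def edgeDifference : (G.BoundedFace → ℝ) →ₗ[ℝ] E → ℝ where
  toFun w e := extendByZero w (G.faceOf (G.exists_black_dart e).choose) -
    extendByZero w (G.faceOf (rev (G.exists_black_dart e).choose))
  map_add' w w' := by
    funext e
    simp only [extendByZero_add, Pi.add_apply]
    ring
  map_smul' c w := by
    funext e
    simp only [extendByZero_smul, Pi.smul_apply, smul_eq_mul, RingHom.id_apply]
    ring

lemma edgeDifference_apply (w : G.BoundedFace → ℝ) {d : E × Bool} (hd : G.tail d ∈ G.black) :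
    G.edgeDifference w d.1 =
      extendByZero w (G.faceOf d) - extendByZero w (G.faceOf (rev d)) := by
  have hdart := (G.exists_black_dart d.1).choose_spec
  have : (G.exists_black_dart d.1).choose = d :=
    dart_eq_of_fst_eq hdart.1 (iff_of_true hdart.2 hd)
  simp only [edgeDifference, LinearMap.coe_mk, AddHom.coe_mk, this]

lemma edgeDifference_injective : Function.Injective G.edgeDifference := by
  rw [injective_iff_map_eq_zero]
  intro w hw
  have hd : ∀ d, G.tail d ∈ G.black →
      extendByZero w (G.faceOf d) = extendByZero w (G.faceOf (rev d)) := by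
    intro d hd
    have := edgeDifference_apply w hd
    rw [hw, Pi.zero_apply] at this
    linarith
  funext f
  rw [← extendByZero_boundedFace w]
  refine G.face_induction (P := fun f => extendByZero w f = 0) G.infiniteFace
    (extendByZero_infiniteFace w) (fun d hf => ?_) f.1
  by_cases hb : G.tail d ∈ G.black
  · rw [← hd d hb, hf]
  · rw [hd _ ((tail_rev_mem_black_iff d).2 hb), rev_rev, hf]

instance : Finite G.BoundedFace := Subtype.finite

/-- The exponent vector of the multivariate rank of a dimer, as a real vector. -/
def rankVector (M : G.Dimer) : G.BoundedFace → ℝ := fun f => multivariateRank M f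

lemma newtonPolytope_eq : newtonPolytope G.dimerFacePolynomial =
    convexHull ℝ (Set.range (rankVector : G.Dimer → _)) := by
  rw [newtonPolytope, support_dimerFacePolynomial, ← Set.range_comp]
  rfl

lemma Dimer.cast_ind (M : G.Dimer) (e : E) : (M.ind e : ℝ) = M.edges.indicator 1 e := by
  by_cases h : e ∈ M.edges <;> simp [ind, h]

/-- Ranks are heights above `M₀`, whose jumps are the indicator of `M` minus that of `M₀`; this
dictates the translation vector. The exchange property is `sum_sub_le`. -/
lemma PropertyStar.indicatorFamily [Fintype E] (hG : G.PropertyStar) {M₀ : G.Dimer}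
    (h₀ : IsBot M₀) :
    IndicatorFamily (Dimer.edges : G.Dimer → Set E) rankVector G.edgeDifference
      (M₀.edges.indicator 1) where
  nonempty := Dimer.edges_nonempty
  injective := edgeDifference_injective
  map_add M := by
    funext e
    obtain ⟨d, rfl, hd⟩ := G.exists_black_dart e
    rw [Pi.add_apply, edgeDifference_apply _ hd,
      extendByZero_eq (h := fun f => (M.height M₀ f : ℝ)) (by simp) (fun f => by
        rw [← hG.multivariateRank_eq_height h₀, Int.cast_natCast]
        rfl),
      ← Int.cast_sub, M.height_sub M₀ hd, ← Dimer.cast_ind, ← Dimer.cast_ind]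
    push_cast
    ring
  exchange T M hM c α hc := by
    simp only [← Dimer.cast_ind] at hc ⊢
    exact sum_sub_le T M hM hc

end BipartitePlaneGraph

end DimerNewton

end

theorem proposition3 {V E : Type*} (G : DimerNewton.BipartitePlaneGraph V E)
    (hG : G.PropertyStar) :
    Nonempty (DimerNewton.FaceLattice (DimerNewton.newtonPolytope G.dimerFacePolynomial) ≃o
      DimerNewton.ElementarySubgraph G.toGraph) ∧
    ∀ H : Graph V E, DimerNewton.IsElementary H G.toGraph ↔
      H ≤s G.toGraph ∧ ∃ S : Set G.Dimer, E(H) = ⋃ M ∈ S, M.edges := by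
  refine ⟨?_, fun H => DimerNewton.BipartitePlaneGraph.isElementary_iff⟩
  have := G.finite_edges
  have := Fintype.ofFinite E
  obtain ⟨M₀, h₀⟩ := hG.exists_isBot
  rw [DimerNewton.BipartitePlaneGraph.newtonPolytope_eq]
  exact ⟨(hG.indicatorFamily h₀).faceLatticeIso.trans G.unionIso⟩
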